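/- Let $k$ be a natural number and let $\mathcal E\subset\mathbb C^{\mathbb Z^k}$ be a Banach space of complex sequences on $\mathbb Z^k$ which contains the space $F(\mathbb Z^k)$ of finitely supported sequences and satisfies: (h1) $F(\mathbb Z^k)$ is dense in $\mathcal E$; (h2) for every $n\in\mathbb Z^k$ the coordinate map $\mathcal E\ni x\mapsto x(n)\in\mathbb C$ is continuous; (h3) for every $z\in\mathbb T^k$ the map $\psi_z$, $(\psi_z x)(n)=x(n)z_1^{n_1}\cdots z_k^{n_k}$, maps $\mathcal E$ into $\mathcal E$, and $\sup_{z\in\mathbb T^k}\|\psi_z\|<\infty$. Assume moreover that all translations $x\mapsto x(\cdot-m)$, $m\in\mathbb Z^k$, map $\mathcal E$ into $\mathcal E$ (they are then bounded by the closed graph theorem). Write $z^n=z_1^{n_1}\cdots z_k^{n_k}$. For $\phi\in F(\mathbb Z^k)$ let $M_\phi f=\phi*f$ on $\mathcal E$ and $\tilde\phi(z)=\sum_n\phi(n)z^n$, and put $$\mathbb Z^k_{\mathcal E}=\{z\in(\mathbb C\setminus\{0\})^k:\ |\tilde\phi(z)|\le\|M_\phi\|\ \text{ for all }\phi\in F(\mathbb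 Z^k)\}.$$ For a bounded operator $M$ on $\mathcal E$ let $\widehat M=M(e_0)$, where $e_0(0)=1$ and $e_0(n)=0$ for $n\neq0$, let $\widetilde M(z)=\sum_{n\in\mathbb Z^k}\widehat M(n)z^n$ wherever this series converges absolutely, and let $\sigma(M)$ be the spectrum of $M$. Let $\mathcal A$ be the closure, in the operator norm, of the algebra generated by the operators $M_\phi$, $\phi\in F(\mathbb Z^k)$. 1) Let $M$ be a bounded operator on $\mathcal E$ commuting with all translations. Then the series $\widetilde M(z)$ converges absolutely at every interior point $z$ of $\mathbb Z^k_{\mathcal E}$, and the closure of the image under $\widetilde M$ of the interior of $\mathbb Z^k_{\mathcal E}$ is contained in $\sigma(M)$. 2) Let $M\in\mathcal A$. Then there is exactly one continuous function on $\mathbb Z^k_{\mathcal E}$, again denoted $\widetilde M$, such that for every $z\in\mathbb Z^k_{\mathcal E}$ the function $(\eta_1,\dots,\eta_k)\mapsto\widetilde M(z_1\eta_1,\dots,z_k\eta_k)$ on $\mathbb T^k$ has the Fourier coefficients $\widehat M(n)z^n$, $n\in\mathbb Z^k$. It coincides with the series $\sum_n\widehat M(n)z^n$ at every point of $\mathbb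 Z^k_{\mathcal E}$ where this series converges absolutely, it is the uniform limit on $\mathbb Z^k_{\mathcal E}$ of $\tilde\phi_j$ whenever $\phi_j\in F(\mathbb Z^k)$ and $\|M_{\phi_j}-M\|\to0$, and $$\widetilde M(\mathbb Z^k_{\mathcal E})=\sigma(M).$$ -/

import Mathlib

open Filter Topology

noncomputable section

/-- The Laurent monomial `z ^ n = z₁ ^ n₁ ⋯ z_k ^ n_k`, for `n ∈ ℤ^k`. -/
def laurentMonomial {k : ℕ} (z : Fin k → ℂ) (n : Fin k → ℤ) : ℂ := ∏ i, z i ^ n i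

/-- The Laurent polynomial `∑ φ(n) z ^ n` of a finitely supported sequence `φ` on `ℤ^k`. -/
def laurentPolynomial {k : ℕ} (φ : (Fin k → ℤ) →₀ ℂ) (z : Fin k → ℂ) : ℂ :=
  φ.sum fun n c => c * laurentMonomial z n

/-- A structure of Banach space of sequences on `ℤ^k` on the complex normed space `E` (complete
where it is used), satisfying the standing hypotheses. The space `E` is identified with a linear
subspace of `ℂ^(ℤ^k)` through the injective linear map `toSeq`. -/
structure BanachSequenceSpace (k : ℕ) (E : Type*) [NormedAddCommGroup E] [NormedSpace ℂ E] where
  /-- The sequence of an element of the space. -/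
  toSeq : E →ₗ[ℂ] ((Fin k → ℤ) → ℂ)
  toSeq_injective : Function.Injective toSeq
  /-- All finitely supported sequences belong to the space. -/
  exists_of_finite : ∀ a : (Fin k → ℤ) → ℂ, a.support.Finite → ∃ x, toSeq x = a
  /-- The finitely supported sequences are dense. -/
  dense_finite : Dense {x : E | (toSeq x).support.Finite}
  /-- The coordinates are continuous. -/
  continuous_coord : ∀ n : Fin k → ℤ, Continuous fun x => toSeq x n
  /-- For `z` in the torus, `x ↦ (x(n) z ^ n)` maps the space into itself, with norms bounded
  uniformly in `z`. -/
  modulation : ∃ C : ℝ, ∀ z : Fin k → ℂ, (∀ i, ‖z i‖ = 1) → ∀ x : E,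
    ∃ y : E, (∀ n, toSeq y n = toSeq x n * laurentMonomial z n) ∧ ‖y‖ ≤ C * ‖x‖
  /-- The translations (in all directions, positive and negative) map the space into itself. Their
  boundedness follows from the closed graph theorem. -/
  exists_translate : ∀ (m : Fin k → ℤ) (x : E), ∃ y : E, ∀ n, toSeq y n = toSeq x (n - m)

namespace BanachSequenceSpace

variable {k : ℕ} {E : Type*} [NormedAddCommGroup E] [NormedSpace ℂ E]

/-- The translation by `m ∈ ℤ^k`, as a linear map. -/
def translationₗ (X : BanachSequenceSpace k E) (m : Fin k → ℤ) : E →ₗ[ℂ] E where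
  toFun x := (X.exists_translate m x).choose
  map_add' x y := by
    apply X.toSeq_injective
    funext n
    rw [(X.exists_translate m (x + y)).choose_spec n, map_add, map_add, Pi.add_apply, Pi.add_apply,
      (X.exists_translate m x).choose_spec n, (X.exists_translate m y).choose_spec n]
  map_smul' c x := by
    apply X.toSeq_injective
    funext n
    rw [(X.exists_translate m (c • x)).choose_spec n, map_smul, map_smul, Pi.smul_apply,
      Pi.smul_apply, (X.exists_translate m x).choose_spec n, RingHom.id_apply]

theorem toSeq_translationₗ (X : BanachSequenceSpace k E) (m : Fin k → ℤ) (x : E)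
    (n : Fin k → ℤ) : X.toSeq (X.translationₗ m x) n = X.toSeq x (n - m) :=
  (X.exists_translate m x).choose_spec n

theorem translationₗ_closed (X : BanachSequenceSpace k E) (m : Fin k → ℤ) (u : ℕ → E) (x y : E)
    (hx : Tendsto u atTop (𝓝 x)) (hy : Tendsto (X.translationₗ m ∘ u) atTop (𝓝 y)) :
    y = X.translationₗ m x := by
  apply X.toSeq_injective
  funext n
  have h1 := ((X.continuous_coord n).tendsto y).comp hy
  have h2 := ((X.continuous_coord (n - m)).tendsto x).comp hx
  rw [X.toSeq_translationₗ]
  refine tendsto_nhds_unique h1 (h2.congr fun j => ?_)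
  simp [X.toSeq_translationₗ]

/-- The sequence which is `1` at `0` and `0` elsewhere, as an element of the space. -/
def unitSeq (X : BanachSequenceSpace k E) : E :=
  (X.exists_of_finite (Pi.single 0 1)
    ((Set.finite_singleton 0).subset Pi.support_single_subset)).choose

theorem toSeq_unitSeq (X : BanachSequenceSpace k E) : X.toSeq X.unitSeq = Pi.single 0 1 :=
  (X.exists_of_finite (Pi.single 0 1)
    ((Set.finite_singleton 0).subset Pi.support_single_subset)).choose_spec

/-- The sequence of an operator: the value of the operator at the unit sequence. -/
def coeff (X : BanachSequenceSpace k E) (M : E →L[ℂ] E) (n : Fin k → ℤ) : ℂ :=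
  X.toSeq (M X.unitSeq) n

variable [CompleteSpace E]

/-- The translation by `m ∈ ℤ^k`, as a bounded operator: `(S_m x)(n) = x(n - m)`. -/
def translation (X : BanachSequenceSpace k E) (m : Fin k → ℤ) : E →L[ℂ] E :=
  ContinuousLinearMap.ofSeqClosedGraph (X.translationₗ_closed m)

theorem toSeq_translation (X : BanachSequenceSpace k E) (m : Fin k → ℤ) (x : E)
    (n : Fin k → ℤ) : X.toSeq (X.translation m x) n = X.toSeq x (n - m) :=
  X.toSeq_translationₗ m x n

/-- The multipliers: the bounded operators commuting with all translations. -/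
def IsMultiplier (X : BanachSequenceSpace k E) (M : E →L[ℂ] E) : Prop :=
  ∀ m : Fin k → ℤ, Commute M (X.translation m)

/-- The operator `M_φ` of convolution by the finitely supported sequence `φ`. -/
def convOp (X : BanachSequenceSpace k E) (φ : (Fin k → ℤ) →₀ ℂ) : E →L[ℂ] E :=
  φ.sum fun m c => c • X.translation m

theorem toSeq_convOp (X : BanachSequenceSpace k E) (φ : (Fin k → ℤ) →₀ ℂ) (x : E)
    (n : Fin k → ℤ) :
    X.toSeq (X.convOp φ x) n = ∑ m ∈ φ.support, φ m * X.toSeq x (n - m) := by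
  simp [convOp, Finsupp.sum, X.toSeq_translation]

/-- The closure, in the operator norm, of the algebra generated by the operators `M_φ`. -/
def convAlgebra (X : BanachSequenceSpace k E) : Subalgebra ℂ (E →L[ℂ] E) :=
  (Algebra.adjoin ℂ (Set.range X.convOp)).topologicalClosure

/-- The set of all `z` (with nonzero coordinates, so that Laurent polynomials are defined at `z`)
such that `|∑ φ(n) z ^ n| ≤ ‖M_φ‖` for every finitely supported `φ`. -/
def jointSpectrum (X : BanachSequenceSpace k E) : Set (Fin k → ℂ) :=
  {z | (∀ i, z i ≠ 0) ∧ ∀ φ : (Fin k → ℤ) →₀ ℂ, ‖laurentPolynomial φ z‖ ≤ ‖X.convOp φ‖}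

/-- The symbol `∑ n, (coeff M n) z ^ n` of an operator, at the points where the series converges
(absolutely). -/
def symbol (X : BanachSequenceSpace k E) (M : E →L[ℂ] E) (z : Fin k → ℂ) : ℂ :=
  ∑' n : Fin k → ℤ, X.coeff M n * laurentMonomial z n

/-- `g` is a continuous function on the joint spectrum which has `∑ n, (coeff M n) z ^ n` as its
Laurent series: for every `z` in the joint spectrum, the function `η ↦ g (z₁ η₁, …, z_k η_k)` on the
torus has the Fourier coefficients `(coeff M n) z ^ n`. This is the symbol of `M` on the whole
joint spectrum, including the points where the series does not converge. -/
def IsContinuousSymbol (X : BanachSequenceSpace k E) (M : E →L[ℂ] E)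
    (g : (Fin k → ℂ) → ℂ) : Prop :=
  ContinuousOn g X.jointSpectrum ∧
    ∀ z ∈ X.jointSpectrum, ∀ n : Fin k → ℤ,
      UnitAddTorus.mFourierCoeff
        (fun t : UnitAddTorus (Fin k) => g fun i => z i * (AddCircle.toCircle (t i) : ℂ)) n =
      X.coeff M n * laurentMonomial z n

end BanachSequenceSpace

end

/-!
Conjugation by the modulations makes the torus act on the bounded operators, and the `n`-th Fourier
coefficient of the orbit of a multiplier `M` is `M̂(n) S_n`, where `S_n` is the translation by `n`.
The terms `M̂(n) zⁿ` are therefore bounded on the joint spectrum, so by Abel's lemma the series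
converges absolutely in its interior. There it defines a character of the algebra of multipliers;
this algebra contains the inverses of its elements, so the values of the series lie in `σ(M)`.

The algebra `𝒜` consists of the multipliers with a norm-continuous orbit, so it also contains the
inverses of its elements and `σ(M)` is the spectrum of `M` in the commutative Banach algebra `𝒜`.
A character of `𝒜` is determined by its values at the translations, which identifies the characters
with the points of the joint spectrum, and the continuous function sought is the Gelfand transform.
-/

noncomputable section

open UnitAddTorus MeasureTheory

section Summability

theorem summable_pi_prod_of_nonneg {ι : Type*} [Fintype ι] {κ : ι → Type*} {f : ∀ i, κ i → ℝ}
    (hf : ∀ i a, 0 ≤ f i a) (hs : ∀ i, Summable (f i)) :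
    Summable fun x : ∀ i, κ i => ∏ i, f i (x i) := by
  classical
  refine summable_of_sum_le (c := ∏ i, ∑' a, f i a)
    (fun x => Finset.prod_nonneg fun i _ => hf i (x i)) fun u => ?_
  have hu : u ⊆ Fintype.piFinset fun i => u.image (· i) := fun x hx =>
    Fintype.mem_piFinset.2 fun i => Finset.mem_image_of_mem _ hx
  calc ∑ x ∈ u, ∏ i, f i (x i)
      ≤ ∑ x ∈ Fintype.piFinset fun i => u.image (· i), ∏ i, f i (x i) :=
        Finset.sum_le_sum_of_subset_of_nonneg hu
          fun x _ _ => Finset.prod_nonneg fun i _ => hf i (x i)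
    _ = ∏ i, ∑ a ∈ u.image (· i), f i a := (Finset.prod_univ_sum _ _).symm
    _ ≤ ∏ i, ∑' a, f i a := Finset.prod_le_prod
        (fun i _ => Finset.sum_nonneg fun a _ => hf i a)
        fun i _ => (hs i).sum_le_tsum _ fun a _ => hf i a

variable {G R : Type*} [AddGroup G] [NormedRing R] [CompleteSpace R] {f g : G → R}

theorem summable_mul_sub_of_summable_norm (hf : Summable (‖f ·‖)) (hg : Summable (‖g ·‖))
    (n : G) : Summable fun m => f m * g (n - m) :=
  (summable_mul_of_summable_norm hf hg).comp_injective (i := fun m => (m, n - m))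
    fun _ _ h => congrArg Prod.fst h

theorem hasSum_tsum_mul_sub_of_summable_norm (hf : Summable (‖f ·‖)) (hg : Summable (‖g ·‖)) :
    HasSum (fun n => ∑' m, f m * g (n - m)) ((∑' m, f m) * ∑' m, g m) := by
  let e : G × G ≃ G × G :=
    { toFun := fun p => (p.2, p.1 - p.2)
      invFun := fun p => (p.2 + p.1, p.1)
      left_inv := fun p => by simp
      right_inv := fun p => by simp }
  have h := (summable_mul_of_summable_norm hf hg).hasSum
  rw [← tsum_mul_tsum_of_summable_norm hf hg, ← e.hasSum_iff] at h
  exact h.prod_fiberwise fun n => (summable_mul_sub_of_summable_norm hf hg n).hasSum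

end Summability

section AlgHom

variable {𝕜 P A B : Type*} [NontriviallyNormedField 𝕜] [Ring P] [Algebra 𝕜 P] [NormedRing A]
  [NormedAlgebra 𝕜 A] [NormedRing B] [NormedAlgebra 𝕜 B] [CompleteSpace B]

theorem exists_algHom_comp_eq_of_norm_le {i : P →ₐ[𝕜] A} (hi : DenseRange i) {f : P →ₐ[𝕜] B}
    {C : ℝ} (hf : ∀ p, ‖f p‖ ≤ C * ‖i p‖) : ∃ g : A →ₐ[𝕜] B, g.comp i = f := by
  let g : A →L[𝕜] B := f.toLinearMap.extendOfNorm i.toLinearMap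
  have hg (p : P) : g (i p) = f p := LinearMap.extendOfNorm_eq hi ⟨C, hf⟩ p
  have hg_mul (a b : A) : g (a * b) = g a * g b := by
    refine hi.induction_on₂ (p := fun a b => g (a * b) = g a * g b)
      (isClosed_eq (by fun_prop) (by fun_prop)) (fun p q => ?_) a b
    rw [← map_mul, hg, hg, hg, map_mul]
  exact ⟨AlgHom.ofLinearMap g.toLinearMap (by simpa using hg 1) hg_mul, AlgHom.ext hg⟩

end AlgHom

section InverseClosed

variable {R A : Type*} [CommRing R] [Ring A] [Algebra R A] {S : Subalgebra R A}

theorem spectrum_coe_of_forall_inv_mem (hS : ∀ u : Aˣ, (u : A) ∈ S → (↑u⁻¹ : A) ∈ S) (a : S) :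
    spectrum R (a : A) = spectrum R a := by
  ext c
  rw [spectrum.mem_iff, spectrum.mem_iff, not_iff_not]
  refine ⟨fun ⟨u, hu⟩ => ?_, fun h => h.map S.val⟩
  have hu_mem : (u : A) ∈ S := hu ▸ S.sub_mem (S.algebraMap_mem c) a.2
  exact isUnit_iff_exists.2 ⟨⟨↑u⁻¹, hS u hu_mem⟩, Subtype.ext (by simp [← hu]),
    Subtype.ext (by simp [← hu])⟩

end InverseClosed

section Gelfand

theorem mem_spectrum_iff_exists_algHom {A : Type*} [NormedRing A] [NormedAlgebra ℂ A]
    [CompleteSpace A] [IsMulCommutative A] {a : A} {c : ℂ} :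
    c ∈ spectrum ℂ a ↔ ∃ χ : A →ₐ[ℂ] ℂ, χ a = c := by
  let _ : NormedCommRing A := { ‹NormedRing A› with mul_comm := mul_comm' }
  exact WeakDual.CharacterSpace.mem_spectrum_iff_exists.trans
    WeakDual.CharacterSpace.equivAlgHom.exists_congr_left

end Gelfand

section Fourier

variable {d : Type*} [Fintype d]

/-- The normalised Haar measure of the torus `(ℝ / ℤ) ^ d`, the measure which the coefficients
`UnitAddTorus.mFourierCoeff` integrate against (through an instance local to Mathlib). -/
abbrev haarTorus (d : Type*) [Fintype d] : Measure (UnitAddTorus d) :=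
  Measure.pi fun _ => AddCircle.haarAddCircle

theorem mFourier_apply_add (n : d → ℤ) (s t : UnitAddTorus d) :
    mFourier n (s + t) = mFourier n s * mFourier n t := by
  simp [mFourier, fourier_apply, smul_add, AddCircle.toCircle_add, Finset.prod_mul_distrib]

theorem mFourier_apply_zero (n : d → ℤ) : mFourier n (0 : UnitAddTorus d) = 1 := by
  simp [mFourier]

theorem norm_mFourier_apply (n : d → ℤ) (t : UnitAddTorus d) : ‖mFourier n t‖ = 1 := by
  simp only [mFourier, fourier_apply, ContinuousMap.coe_mk, norm_prod, Circle.norm_coe,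
    Finset.prod_const_one]

variable {F G : Type*} [NormedAddCommGroup F] [NormedSpace ℂ F] [NormedAddCommGroup G]
  [NormedSpace ℂ G] {f g : UnitAddTorus d → F}

theorem mFourierCoeff_eq_integral_haarTorus (f : UnitAddTorus d → F) (n : d → ℤ) :
    mFourierCoeff f n = ∫ t, mFourier (-n) t • f t ∂haarTorus d := rfl

theorem integrable_mFourier_smul (hf : Continuous f) (n : d → ℤ) :
    Integrable (fun t => mFourier n t • f t) (haarTorus d) :=
  ((mFourier n).continuous.smul hf).integrable_of_hasCompactSupport
    (HasCompactSupport.of_compactSpace _)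

theorem mFourierCoeff_add (hf : Continuous f) (hg : Continuous g) (n : d → ℤ) :
    mFourierCoeff (fun t => f t + g t) n = mFourierCoeff f n + mFourierCoeff g n := by
  simp only [mFourierCoeff_eq_integral_haarTorus, smul_add]
  exact integral_add (integrable_mFourier_smul hf _) (integrable_mFourier_smul hg _)

theorem mFourierCoeff_sub (hf : Continuous f) (hg : Continuous g) (n : d → ℤ) :
    mFourierCoeff (fun t => f t - g t) n = mFourierCoeff f n - mFourierCoeff g n := by
  simp only [mFourierCoeff_eq_integral_haarTorus, smul_sub]
  exact integral_sub (integrable_mFourier_smul hf _) (integrable_mFourier_smul hg _)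

theorem mFourierCoeff_const_smul (c : ℂ) (f : UnitAddTorus d → F) (n : d → ℤ) :
    mFourierCoeff (fun t => c • f t) n = c • mFourierCoeff f n := by
  simp only [mFourierCoeff_eq_integral_haarTorus, smul_comm _ c]
  exact integral_smul _ _

theorem norm_mFourierCoeff_le {C : ℝ} (hf : ∀ t, ‖f t‖ ≤ C) (n : d → ℤ) :
    ‖mFourierCoeff f n‖ ≤ C := by
  have hbound (t : UnitAddTorus d) : ‖mFourier (-n) t • f t‖ ≤ C := by
    simpa only [norm_smul, norm_mFourier_apply, one_mul] using hf t
  simpa [mFourierCoeff_eq_integral_haarTorus] using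
    norm_integral_le_of_norm_le_const (μ := haarTorus d) (ae_of_all _ hbound)

theorem mFourierCoeff_clm_apply [CompleteSpace F] [CompleteSpace G] (L : F →L[ℂ] G)
    (hf : Continuous f) (n : d → ℤ) :
    mFourierCoeff (fun t => L (f t)) n = L (mFourierCoeff f n) := by
  simp only [mFourierCoeff_eq_integral_haarTorus,
    ← L.integral_comp_comm (integrable_mFourier_smul hf _), map_smul]

theorem mFourierCoeff_mFourier_smul [CompleteSpace F] (m n : d → ℤ) (v : F) :
    mFourierCoeff (fun t => mFourier m t • v) n = if n = m then v else 0 := by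
  have hcoeff : mFourierCoeff (fun t => mFourier m t) n = if n = m then 1 else 0 := by
    rw [← orthonormal_iff_ite.mp orthonormal_mFourier n m]
    simp only [ContinuousMap.inner_toLp, ← mFourier_neg]
    exact integral_congr_ae (ae_of_all _ fun t => mul_comm _ _)
  have hv := mFourierCoeff_clm_apply (ContinuousLinearMap.toSpanSingleton ℂ v)
    (mFourier m).continuous n
  simpa [hcoeff, ite_smul] using hv

theorem hasSum_mFourierCoeff_mul_mFourier {f : UnitAddTorus d → ℂ} (hf : Continuous f)
    (hs : Summable (mFourierCoeff f)) (t : UnitAddTorus d) :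
    HasSum (fun n => mFourierCoeff f n * mFourier n t) (f t) :=
  hasSum_mFourier_series_apply_of_summable (f := ⟨f, hf⟩) hs t

theorem eq_zero_of_mFourierCoeff_eq_zero [CompleteSpace F] (hf : Continuous f)
    (h : ∀ n, mFourierCoeff f n = 0) (t : UnitAddTorus d) : f t = 0 := by
  refine SeparatingDual.eq_zero_of_forall_dual_eq_zero (R := ℂ) fun L => ?_
  have hL (n : d → ℤ) : mFourierCoeff (fun s => L (f s)) n = 0 := by
    rw [mFourierCoeff_clm_apply L hf, h, map_zero]
  have hsum := hasSum_mFourierCoeff_mul_mFourier (L.continuous.comp hf)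
    (by simpa only [Function.comp_def, funext hL] using summable_zero) t
  simp only [Function.comp_def, hL, zero_mul] at hsum
  exact hsum.unique hasSum_zero

theorem eq_of_mFourierCoeff_eq [CompleteSpace F] (hf : Continuous f) (hg : Continuous g)
    (h : ∀ n, mFourierCoeff f n = mFourierCoeff g n) : f = g :=
  funext fun t => sub_eq_zero.1 <| eq_zero_of_mFourierCoeff_eq_zero (hf.sub hg)
    (fun n => by rw [← sub_eq_zero.2 (h n)]; exact mFourierCoeff_sub hf hg n) t

theorem mem_of_forall_mFourierCoeff_mem [CompleteSpace F] {p : Submodule ℂ F}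
    (hp : IsClosed (p : Set F)) (hf : Continuous f) (h : ∀ n, mFourierCoeff f n ∈ p)
    (t : UnitAddTorus d) : f t ∈ p := by
  have : IsClosed (p : Set F) := hp
  refine (Submodule.Quotient.mk_eq_zero p).1 ?_
  refine eq_zero_of_mFourierCoeff_eq_zero (f := fun s => p.mkQL (f s)) (by fun_prop)
    (fun n => ?_) t
  rw [mFourierCoeff_clm_apply _ hf]
  exact (Submodule.Quotient.mk_eq_zero p).2 (h n)

end Fourier

section Laurent

variable {k : ℕ} {z : Fin k → ℂ}

theorem laurentMonomial_zero (z : Fin k → ℂ) : laurentMonomial z 0 = 1 := by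
  simp [laurentMonomial]

theorem laurentMonomial_add (hz : ∀ i, z i ≠ 0) (m n : Fin k → ℤ) :
    laurentMonomial z (m + n) = laurentMonomial z m * laurentMonomial z n := by
  simp [laurentMonomial, zpow_add₀ (hz _), Finset.prod_mul_distrib]

theorem laurentMonomial_ne_zero (hz : ∀ i, z i ≠ 0) (n : Fin k → ℤ) : laurentMonomial z n ≠ 0 :=
  Finset.prod_ne_zero_iff.2 fun i _ => zpow_ne_zero _ (hz i)

theorem laurentMonomial_mul (z w : Fin k → ℂ) (n : Fin k → ℤ) :
    laurentMonomial (z * w) n = laurentMonomial z n * laurentMonomial w n := by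
  simp [laurentMonomial, mul_zpow, Finset.prod_mul_distrib]

theorem laurentMonomial_single (z : Fin k → ℂ) (i : Fin k) :
    laurentMonomial z (Pi.single i 1) = z i := by
  rw [laurentMonomial, Finset.prod_eq_single i (fun j _ hj => by simp [hj]) (by simp)]
  simp

theorem laurentMonomial_toCircle (t : UnitAddTorus (Fin k)) (n : Fin k → ℤ) :
    laurentMonomial (fun i => (AddCircle.toCircle (t i) : ℂ)) n = mFourier n t := by
  simp [laurentMonomial, mFourier, fourier_apply, AddCircle.toCircle_zsmul]

theorem laurentPolynomial_single (n : Fin k → ℤ) (c : ℂ) (z : Fin k → ℂ) :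
    laurentPolynomial (Finsupp.single n c) z = c * laurentMonomial z n :=
  Finsupp.sum_single_index (zero_mul _)

theorem continuousOn_laurentPolynomial (φ : (Fin k → ℤ) →₀ ℂ) :
    ContinuousOn (laurentPolynomial φ) {z | ∀ i, z i ≠ 0} :=
  continuousOn_finsetSum _ fun n _ => continuousOn_const.mul <|
    continuousOn_finsetProd _ fun i _ =>
      (continuous_apply i).continuousOn.zpow₀ (n i) fun _ hz => Or.inl (hz i)

/-- Evaluation at a point `z` with nonzero coordinates, as a character of the algebra of Laurent
polynomials, encoded as the group algebra of `ℤ^k`. -/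
def laurentEval (hz : ∀ i, z i ≠ 0) : AddMonoidAlgebra ℂ (Fin k → ℤ) →ₐ[ℂ] ℂ :=
  AddMonoidAlgebra.lift ℂ ℂ (Fin k → ℤ)
    { toFun := fun n => laurentMonomial z n.toAdd
      map_one' := laurentMonomial_zero z
      map_mul' := fun m n => laurentMonomial_add hz m.toAdd n.toAdd }

theorem laurentEval_apply (hz : ∀ i, z i ≠ 0) (p : AddMonoidAlgebra ℂ (Fin k → ℤ)) :
    laurentEval hz p = laurentPolynomial p.coeff z :=
  AddMonoidAlgebra.lift_apply _ _

theorem monoidHom_apply_eq_laurentMonomial (f : Multiplicative (Fin k → ℤ) →* ℂ)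
    (n : Fin k → ℤ) :
    f (.ofAdd n) = laurentMonomial (fun i => f (.ofAdd (Pi.single i 1))) n := by
  have hn : n = ∑ i, n i • Pi.single i 1 := by
    simp [← Pi.single_smul, Finset.univ_sum_single]
  conv_lhs => rw [hn, ofAdd_sum, map_prod]
  simp only [laurentMonomial, ofAdd_zsmul, map_zpow]

/-- **Abel's lemma** for Laurent series. -/
theorem summable_mul_laurentMonomial_of_mem_interior {a : (Fin k → ℤ) → ℂ} {C : ℝ}
    {s : Set (Fin k → ℂ)} (ha : ∀ w ∈ s, ∀ n, ‖a n * laurentMonomial w n‖ ≤ C)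
    (hz : z ∈ interior s) : Summable fun n => a n * laurentMonomial z n := by
  let dilate (ρ : ℝ) (ε : Fin k → SignType) : Fin k → ℂ := fun i => z i * (ρ : ℂ) ^ (ε i : ℤ)
  have hdilate_mem : ∀ᶠ ρ in 𝓝 1, ∀ ε, dilate ρ ε ∈ s := by
    refine eventually_all.2 fun ε => ?_
    have hcont : ContinuousAt (dilate · ε) 1 := continuousAt_pi.2 fun i =>
      continuousAt_const.mul (Complex.continuous_ofReal.continuousAt.zpow₀ _ (by simp))
    refine hcont.preimage_mem_nhds ?_
    simpa [dilate] using mem_interior_iff_mem_nhds.1 hz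
  obtain ⟨ρ, hρs, hρ⟩ : ∃ ρ : ℝ, (∀ ε, dilate ρ ε ∈ s) ∧ 1 < ρ :=
    ((hdilate_mem.filter_mono nhdsWithin_le_nhds).and (self_mem_nhdsWithin (s := Set.Ioi 1))).exists
  have hρ0 : 0 < ρ := one_pos.trans hρ
  have hmonomial (n : Fin k → ℤ) : laurentMonomial (dilate ρ fun i => SignType.sign (n i)) n =
      laurentMonomial z n * ∏ i, (ρ : ℂ) ^ (n i).natAbs := by
    simp only [laurentMonomial, dilate, mul_zpow, ← zpow_mul, sign_mul_self, Int.abs_eq_natAbs,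
      zpow_natCast, Finset.prod_mul_distrib]
  have hgeom : Summable fun m : ℤ => ρ⁻¹ ^ m.natAbs := by
    have hr := summable_geometric_of_lt_one (inv_nonneg.2 hρ0.le) (inv_lt_one_of_one_lt₀ hρ)
    exact .of_nat_of_neg (by simpa using hr) (by simpa using hr)
  refine ((summable_pi_prod_of_nonneg (fun _ _ => by positivity) fun _ : Fin k => hgeom).mul_left
    C).of_norm_bounded fun n => ?_
  have hn := ha _ (hρs fun i => SignType.sign (n i)) n
  rw [hmonomial, ← mul_assoc, norm_mul, norm_prod] at hn
  simpa [abs_of_pos hρ0, ← div_eq_mul_inv, le_div_iff₀ (Finset.prod_pos fun _ _ => pow_pos hρ0 _)]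
    using hn

/-- The action of the torus on `ℂ^k` by rotation of the coordinates. -/
def rotate (z : Fin k → ℂ) (t : UnitAddTorus (Fin k)) : Fin k → ℂ :=
  fun i => z i * (AddCircle.toCircle (t i) : ℂ)

theorem laurentMonomial_rotate (z : Fin k → ℂ) (t : UnitAddTorus (Fin k)) (n : Fin k → ℤ) :
    laurentMonomial (rotate z t) n = laurentMonomial z n * mFourier n t := by
  rw [← laurentMonomial_toCircle, ← laurentMonomial_mul]
  rfl

theorem rotate_zero (z : Fin k → ℂ) : rotate z 0 = z := by
  funext i
  simp [rotate]

theorem continuous_rotate (z : Fin k → ℂ) : Continuous (rotate z) := by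
  unfold rotate
  fun_prop

end Laurent

namespace BanachSequenceSpace

variable {k : ℕ} {E : Type*} [NormedAddCommGroup E] [NormedSpace ℂ E]

section Modulation

variable (X : BanachSequenceSpace k E)

theorem ext_toSeq {x y : E} (h : ∀ n, X.toSeq x n = X.toSeq y n) : x = y :=
  X.toSeq_injective (funext h)

/-- The coordinate `x ↦ x(n)`, as a continuous linear functional. -/
def coord (n : Fin k → ℤ) : E →L[ℂ] ℂ :=
  ⟨LinearMap.proj n ∘ₗ X.toSeq, X.continuous_coord n⟩

@[simp]
theorem coord_apply (n : Fin k → ℤ) (x : E) : X.coord n x = X.toSeq x n := rfl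

theorem symbol_one (z : Fin k → ℂ) : X.symbol 1 z = 1 := by
  rw [symbol, tsum_eq_single 0 fun n hn => by simp [coeff, toSeq_unitSeq, hn]]
  simp [coeff, toSeq_unitSeq, laurentMonomial_zero]

theorem exists_modulate : ∃ C : NNReal, ∀ t : UnitAddTorus (Fin k), ∃ U : E →L[ℂ] E,
    (∀ x n, X.toSeq (U x) n = X.toSeq x n * mFourier n t) ∧ ‖U‖ ≤ C := by
  obtain ⟨C, hC⟩ := X.modulation
  refine ⟨C.toNNReal, fun t => ?_⟩
  choose U hU hUC using hC (fun i => (AddCircle.toCircle (t i) : ℂ)) fun i => Circle.norm_coe _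
  simp only [laurentMonomial_toCircle] at hU
  let Uₗ : E →ₗ[ℂ] E :=
    { toFun := U
      map_add' := fun x y => X.ext_toSeq fun n => by simp [hU, add_mul]
      map_smul' := fun c x => X.ext_toSeq fun n => by simp [hU, mul_assoc] }
  refine ⟨Uₗ.mkContinuous C.toNNReal fun x => (hUC x).trans ?_, hU,
    LinearMap.mkContinuous_norm_le _ (by positivity) _⟩
  gcongr
  exact C.le_coe_toNNReal

/-- A uniform bound for the norms of the modulations. -/
def modBound : NNReal := X.exists_modulate.choose

/-- The modulation `x ↦ (x(n) z ^ n)`, for the point `z` of the torus with arguments `t`. -/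
def modulate (t : UnitAddTorus (Fin k)) : E →L[ℂ] E := (X.exists_modulate.choose_spec t).choose

@[simp]
theorem toSeq_modulate (t : UnitAddTorus (Fin k)) (x : E) (n : Fin k → ℤ) :
    X.toSeq (X.modulate t x) n = X.toSeq x n * mFourier n t :=
  (X.exists_modulate.choose_spec t).choose_spec.1 x n

theorem norm_modulate_le (t : UnitAddTorus (Fin k)) : ‖X.modulate t‖ ≤ X.modBound :=
  (X.exists_modulate.choose_spec t).choose_spec.2

theorem modulate_zero (x : E) : X.modulate 0 x = x :=
  X.ext_toSeq fun n => by simp [mFourier_apply_zero]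

theorem modulate_add (s t : UnitAddTorus (Fin k)) (x : E) :
    X.modulate (s + t) x = X.modulate s (X.modulate t x) :=
  X.ext_toSeq fun n => by simp only [toSeq_modulate, mFourier_apply_add]; ring

/-- The modulations as invertible operators. -/
def modulateEquiv (t : UnitAddTorus (Fin k)) : E ≃L[ℂ] E :=
  .equivOfInverse (X.modulate t) (X.modulate (-t))
    (fun x => by rw [← modulate_add, neg_add_cancel, modulate_zero])
    (fun x => by rw [← modulate_add, add_neg_cancel, modulate_zero])

/-- The action of the torus on the bounded operators, by conjugation with the modulations. -/
def conj (t : UnitAddTorus (Fin k)) : (E →L[ℂ] E) ≃A[ℂ] (E →L[ℂ] E) :=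
  (X.modulateEquiv t).conjContinuousAlgEquiv

theorem conj_apply (t : UnitAddTorus (Fin k)) (T : E →L[ℂ] E) (x : E) :
    X.conj t T x = X.modulate t (T (X.modulate (-t) x)) := rfl

theorem conj_zero (T : E →L[ℂ] E) : X.conj 0 T = T := by
  ext x
  rw [conj_apply, neg_zero, modulate_zero, modulate_zero]

theorem norm_conj_le (t : UnitAddTorus (Fin k)) (T : E →L[ℂ] E) :
    ‖X.conj t T‖ ≤ X.modBound ^ 2 * ‖T‖ := by
  calc ‖X.conj t T‖ ≤ ‖X.modulate t‖ * (‖T‖ * ‖X.modulate (-t)‖) :=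
        (ContinuousLinearMap.opNorm_comp_le _ _).trans
          (mul_le_mul_of_nonneg_left (ContinuousLinearMap.opNorm_comp_le _ _) (norm_nonneg _))
    _ ≤ X.modBound * (‖T‖ * X.modBound) := by gcongr <;> exact X.norm_modulate_le _
    _ = X.modBound ^ 2 * ‖T‖ := by ring

end Modulation

variable [CompleteSpace E] (X : BanachSequenceSpace k E)

section Basis

theorem translation_zero : X.translation 0 = 1 := by
  ext x
  exact X.ext_toSeq fun n => by simp [toSeq_translation]

theorem translation_add (m n : Fin k → ℤ) :
    X.translation (m + n) = X.translation m * X.translation n := by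
  ext x
  exact X.ext_toSeq fun j => by simp [toSeq_translation, sub_sub]

/-- The sequence which is `1` at `m` and `0` elsewhere. -/
def basisSeq (m : Fin k → ℤ) : E := X.translation m X.unitSeq

theorem toSeq_basisSeq (m n : Fin k → ℤ) :
    X.toSeq (X.basisSeq m) n = if n = m then 1 else 0 := by
  simp [basisSeq, toSeq_translation, toSeq_unitSeq, Pi.single_apply, sub_eq_zero]

theorem basisSeq_zero : X.basisSeq 0 = X.unitSeq := by
  rw [basisSeq, translation_zero, one_apply_eq_self]

theorem dense_span_basisSeq : Dense (Submodule.span ℂ (Set.range X.basisSeq) : Set E) := by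
  refine X.dense_finite.mono fun x hx => ?_
  have hx_sum : x = ∑ m ∈ hx.toFinset, X.toSeq x m • X.basisSeq m :=
    X.ext_toSeq fun n => by simp +contextual [toSeq_basisSeq]
  rw [hx_sum]
  exact Submodule.sum_mem _ fun m _ => Submodule.smul_mem _ _ (Submodule.subset_span ⟨m, rfl⟩)

theorem modulate_basisSeq (t : UnitAddTorus (Fin k)) (m : Fin k → ℤ) :
    X.modulate t (X.basisSeq m) = mFourier m t • X.basisSeq m :=
  X.ext_toSeq fun n => by by_cases hn : n = m <;> simp [toSeq_basisSeq, hn]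

theorem modulate_unitSeq (t : UnitAddTorus (Fin k)) : X.modulate t X.unitSeq = X.unitSeq := by
  rw [← basisSeq_zero, modulate_basisSeq, mFourier_zero, ContinuousMap.one_apply, one_smul]

theorem continuous_modulate :
    Continuous fun p : E × UnitAddTorus (Fin k) => X.modulate p.2 p.1 := by
  refine continuous_prod_of_dense_continuous_lipschitzWith _ X.modBound X.dense_span_basisSeq
    (fun x hx => ?_)
    fun t => ContinuousLinearMap.lipschitzWith_of_opNorm_le (X.norm_modulate_le t)
  induction hx using Submodule.span_induction with
  | mem x hx =>
    obtain ⟨m, rfl⟩ := hx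
    simp only [modulate_basisSeq]
    fun_prop
  | zero => simpa only [map_zero] using continuous_const
  | add x y _ _ hx hy => simpa only [map_add] using! hx.add hy
  | smul c x _ hx => simpa only [map_smul] using! hx.const_smul c

theorem continuous_modulate_apply (x : E) : Continuous fun t => X.modulate t x :=
  X.continuous_modulate.comp₂ continuous_const continuous_id

theorem continuous_conj_apply (T : E →L[ℂ] E) (x : E) : Continuous fun t => X.conj t T x := by
  have hT : Continuous fun t => T (X.modulate (-t) x) :=
    T.continuous.comp ((X.continuous_modulate_apply x).comp continuous_neg)
  exact X.continuous_modulate.comp₂ hT continuous_id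

theorem conj_translation (t : UnitAddTorus (Fin k)) (m : Fin k → ℤ) :
    X.conj t (X.translation m) = mFourier m t • X.translation m := by
  ext x
  refine X.ext_toSeq fun n => ?_
  have hn : mFourier (n - m) (-t) * mFourier n t = mFourier m t := by
    have hcancel : mFourier (n - m) (-t) * mFourier (n - m) t = 1 := by
      rw [← mFourier_apply_add, neg_add_cancel, mFourier_apply_zero]
    calc mFourier (n - m) (-t) * mFourier n t
        = mFourier (n - m) (-t) * mFourier (n - m) t * mFourier m t := by
          rw [mul_assoc, ← mFourier_add, sub_add_cancel]
      _ = mFourier m t := by rw [hcancel, one_mul]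
  simp only [conj_apply, toSeq_modulate, toSeq_translation, smul_apply, map_smul, Pi.smul_apply,
    smul_eq_mul, mul_assoc, hn]
  exact mul_comm _ _

theorem mFourierCoeff_modulate_apply (x : E) (n : Fin k → ℤ) :
    mFourierCoeff (fun t => X.modulate t x) n = X.toSeq x n • X.basisSeq n := by
  refine X.ext_toSeq fun j => ?_
  have hcoord : X.toSeq (mFourierCoeff (fun t => X.modulate t x) n) j =
      mFourierCoeff (fun t => mFourier j t • X.toSeq x j) n := by
    rw [← coord_apply, ← mFourierCoeff_clm_apply _ (X.continuous_modulate_apply x)]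
    simp only [coord_apply, toSeq_modulate, smul_eq_mul, mul_comm]
  rw [hcoord, mFourierCoeff_mFourier_smul]
  by_cases hj : n = j <;> simp [toSeq_basisSeq, hj, eq_comm]

/-- Applying a functional termwise is legitimate only because the terms are the Fourier
coefficients of a continuous function: `∑ x(m) e_m` need not converge to `x`. -/
theorem hasSum_toSeq_mul_apply_basisSeq (L : E →L[ℂ] ℂ) (x : E)
    (hs : Summable fun m => X.toSeq x m * L (X.basisSeq m)) :
    HasSum (fun m => X.toSeq x m * L (X.basisSeq m)) (L x) := by
  have hcoeff : mFourierCoeff (fun t => L (X.modulate t x)) =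
      fun m => X.toSeq x m * L (X.basisSeq m) := by
    funext m
    rw [mFourierCoeff_clm_apply L (X.continuous_modulate_apply x), mFourierCoeff_modulate_apply,
      map_smul, smul_eq_mul]
  have hsum := hasSum_mFourierCoeff_mul_mFourier
    (L.continuous.comp (X.continuous_modulate_apply x)) (t := 0)
  simp only [Function.comp_def, hcoeff, mFourier_apply_zero, mul_one, modulate_zero] at hsum
  exact hsum hs

end Basis

section Multiplier

/-- The algebra of multipliers. -/
def multiplierAlgebra : Subalgebra ℂ (E →L[ℂ] E) :=
  Subalgebra.centralizer ℂ (Set.range X.translation)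

variable {X} {M N : E →L[ℂ] E} {z : Fin k → ℂ}

theorem mem_multiplierAlgebra : M ∈ X.multiplierAlgebra ↔ X.IsMultiplier M := by
  simp only [multiplierAlgebra, Subalgebra.mem_centralizer_iff, Set.forall_mem_range, IsMultiplier,
    Commute, SemiconjBy, eq_comm]

theorem isMultiplier_translation (n : Fin k → ℤ) : X.IsMultiplier (X.translation n) := fun m => by
  rw [Commute, SemiconjBy, ← translation_add, ← translation_add, add_comm]

namespace IsMultiplier

theorem inv {u : (E →L[ℂ] E)ˣ} (hu : X.IsMultiplier (u : E →L[ℂ] E)) :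
    X.IsMultiplier (↑u⁻¹ : E →L[ℂ] E) :=
  fun m => (hu m).units_inv_left

theorem conj (hM : X.IsMultiplier M) (t : UnitAddTorus (Fin k)) : X.IsMultiplier (X.conj t M) :=
  fun m => by
    have h := (hM m).map (X.conj t)
    have hne : mFourier m t ≠ 0 := norm_ne_zero_iff.1 (by simp [norm_mFourier_apply])
    rwa [conj_translation, Commute.smul_right_iff₀ hne] at h

theorem apply_basisSeq (hM : X.IsMultiplier M) (m : Fin k → ℤ) :
    M (X.basisSeq m) = X.translation m (M X.unitSeq) :=
  DFunLike.congr_fun (hM m).eq X.unitSeq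

theorem ext_unitSeq (hM : X.IsMultiplier M) (hN : X.IsMultiplier N)
    (h : M X.unitSeq = N X.unitSeq) : M = N := by
  refine ContinuousLinearMap.ext_on X.dense_span_basisSeq ?_
  rintro _ ⟨m, rfl⟩
  rw [hM.apply_basisSeq, hN.apply_basisSeq, h]

end IsMultiplier

variable (X) in
/-- The `n`-th Fourier coefficient of the orbit `t ↦ conj t M`, taken in the strong operator
topology, in which every orbit is continuous. -/
def conjCoeff (M : E →L[ℂ] E) (n : Fin k → ℤ) : E →L[ℂ] E :=
  LinearMap.mkContinuous
    { toFun := fun x => mFourierCoeff (fun t => X.conj t M x) n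
      map_add' := fun x y => by
        simp only [map_add]
        exact mFourierCoeff_add (X.continuous_conj_apply M x) (X.continuous_conj_apply M y) n
      map_smul' := fun c x => by
        simp only [map_smul, RingHom.id_apply]
        exact mFourierCoeff_const_smul c _ n }
    (X.modBound ^ 2 * ‖M‖)
    fun x => norm_mFourierCoeff_le
      (fun t => (X.conj t M).le_of_opNorm_le (X.norm_conj_le t M) x) n

theorem norm_conjCoeff_le (M : E →L[ℂ] E) (n : Fin k → ℤ) :
    ‖X.conjCoeff M n‖ ≤ X.modBound ^ 2 * ‖M‖ :=
  LinearMap.mkContinuous_norm_le _ (by positivity) _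

theorem conjCoeff_apply (M : E →L[ℂ] E) (n : Fin k → ℤ) (x : E) :
    X.conjCoeff M n x = mFourierCoeff (fun t => X.conj t M x) n := rfl

namespace IsMultiplier

theorem conjCoeff (hM : X.IsMultiplier M) (n : Fin k → ℤ) :
    X.IsMultiplier (X.conjCoeff M n) := fun m => by
  ext x
  have hcomm (t : UnitAddTorus (Fin k)) :
      X.conj t M (X.translation m x) = X.translation m (X.conj t M x) :=
    DFunLike.congr_fun (hM.conj t m).eq x
  simp only [mul_apply_eq_comp, conjCoeff_apply, hcomm]
  exact mFourierCoeff_clm_apply _ (X.continuous_conj_apply M x) n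

theorem conjCoeff_eq (hM : X.IsMultiplier M) (n : Fin k → ℤ) :
    X.conjCoeff M n = X.coeff M n • X.translation n := by
  refine (hM.conjCoeff n).ext_unitSeq (fun m => (isMultiplier_translation n m).smul_left _) ?_
  simp only [conjCoeff_apply, conj_apply, modulate_unitSeq, mFourierCoeff_modulate_apply,
    smul_apply, basisSeq, coeff]

theorem toSeq_apply_basisSeq (hM : X.IsMultiplier M) (m n : Fin k → ℤ) :
    X.toSeq (M (X.basisSeq m)) n = X.coeff M (n - m) := by
  rw [hM.apply_basisSeq, toSeq_translation, coeff]

theorem hasSum_coeff_mul (hM : X.IsMultiplier M) (n : Fin k → ℤ)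
    (hs : Summable fun m => X.coeff N m * X.coeff M (n - m)) :
    HasSum (fun m => X.coeff N m * X.coeff M (n - m)) (X.coeff (M * N) n) := by
  have hsum := X.hasSum_toSeq_mul_apply_basisSeq (X.coord n ∘SL M) (N X.unitSeq)
  simp only [ContinuousLinearMap.comp_apply, coord_apply, hM.toSeq_apply_basisSeq] at hsum
  exact hsum hs

theorem symbol_mul (hM : X.IsMultiplier M) (hz : ∀ i, z i ≠ 0)
    (hMs : Summable fun n => X.coeff M n * laurentMonomial z n)
    (hNs : Summable fun n => X.coeff N n * laurentMonomial z n) :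
    X.symbol (M * N) z = X.symbol M z * X.symbol N z := by
  have hterm (n m : Fin k → ℤ) :
      X.coeff N m * laurentMonomial z m * (X.coeff M (n - m) * laurentMonomial z (n - m)) =
        X.coeff N m * X.coeff M (n - m) * laurentMonomial z n := by
    rw [mul_mul_mul_comm, ← laurentMonomial_add hz, add_sub_cancel]
  have hzn (n : Fin k → ℤ) := laurentMonomial_ne_zero hz n
  have hfibre (n : Fin k → ℤ) : ∑' m, X.coeff N m * laurentMonomial z m *
      (X.coeff M (n - m) * laurentMonomial z (n - m)) =
        X.coeff (M * N) n * laurentMonomial z n := by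
    have hs := summable_mul_sub_of_summable_norm hNs.norm hMs.norm n
    simp only [hterm, summable_mul_right_iff (hzn n)] at hs ⊢
    exact ((hM.hasSum_coeff_mul n hs).mul_right _).tsum_eq
  have hsum := hasSum_tsum_mul_sub_of_summable_norm hNs.norm hMs.norm
  simp only [hfibre] at hsum
  exact hsum.tsum_eq.trans (mul_comm _ _)

end IsMultiplier

theorem norm_mul_laurentMonomial_le (hz : z ∈ X.jointSpectrum) (c : ℂ) (n : Fin k → ℤ) :
    ‖c * laurentMonomial z n‖ ≤ ‖c • X.translation n‖ := by
  simpa [laurentPolynomial_single, convOp] using hz.2 (Finsupp.single n c)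

theorem IsMultiplier.summable_coeff_mul_laurentMonomial (hM : X.IsMultiplier M)
    (hz : z ∈ interior X.jointSpectrum) :
    Summable fun n => X.coeff M n * laurentMonomial z n :=
  summable_mul_laurentMonomial_of_mem_interior
    (fun _ hw n => (norm_mul_laurentMonomial_le hw _ n).trans
      (hM.conjCoeff_eq n ▸ norm_conjCoeff_le M n)) hz

/-- The symbol at an interior point of the joint spectrum, as a character of the algebra of
multipliers. -/
def symbolHom (hz : z ∈ interior X.jointSpectrum) : X.multiplierAlgebra →ₐ[ℂ] ℂ :=
  have hs (M : X.multiplierAlgebra) :=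
    (mem_multiplierAlgebra.1 M.2).summable_coeff_mul_laurentMonomial hz
  .ofLinearMap
    { toFun := fun M => X.symbol M z
      map_add' := fun M N => by
        simpa [symbol, coeff, add_mul] using (hs M).tsum_add (hs N)
      map_smul' := fun c M => by
        simp [symbol, coeff, mul_assoc, tsum_mul_left] }
    (X.symbol_one z)
    fun M N => (mem_multiplierAlgebra.1 M.2).symbol_mul (interior_subset hz).1 (hs M) (hs N)

theorem IsMultiplier.symbol_mem_spectrum (hM : X.IsMultiplier M)
    (hz : z ∈ interior X.jointSpectrum) : X.symbol M z ∈ spectrum ℂ M := by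
  have hinv (u : (E →L[ℂ] E)ˣ) (hu : (u : E →L[ℂ] E) ∈ X.multiplierAlgebra) :
      (↑u⁻¹ : E →L[ℂ] E) ∈ X.multiplierAlgebra :=
    mem_multiplierAlgebra.2 (mem_multiplierAlgebra.1 hu).inv
  let M' : X.multiplierAlgebra := ⟨M, mem_multiplierAlgebra.2 hM⟩
  exact spectrum_coe_of_forall_inv_mem hinv M' ▸ AlgHom.apply_mem_spectrum (symbolHom hz) M'

end Multiplier

section ConvAlgebra

theorem translation_mem_convAlgebra (n : Fin k → ℤ) : X.translation n ∈ X.convAlgebra :=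
  Subalgebra.le_topologicalClosure _ <|
    Algebra.subset_adjoin ⟨Finsupp.single n 1, by simp [convOp]⟩

theorem convAlgebra_le {S : Subalgebra ℂ (E →L[ℂ] E)} (hS : IsClosed (S : Set (E →L[ℂ] E)))
    (h : ∀ n, X.translation n ∈ S) : X.convAlgebra ≤ S :=
  Subalgebra.topologicalClosure_minimal
    (Algebra.adjoin_le <| Set.range_subset_iff.2 fun _ =>
      S.sum_mem fun n _ => S.smul_mem (h n) _) hS

variable {X} in
theorem isMultiplier_of_mem_convAlgebra {M : E →L[ℂ] E} (hM : M ∈ X.convAlgebra) :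
    X.IsMultiplier M :=
  mem_multiplierAlgebra.1 <| X.convAlgebra_le (Set.isClosed_centralizer _)
    (fun n => mem_multiplierAlgebra.2 (isMultiplier_translation n)) hM

theorem conj_mem_convAlgebra (t : UnitAddTorus (Fin k)) {M : E →L[ℂ] E}
    (hM : M ∈ X.convAlgebra) : X.conj t M ∈ X.convAlgebra := by
  refine X.convAlgebra_le (S := X.convAlgebra.comap (X.conj t : (E →L[ℂ] E) →ₐ[ℂ] (E →L[ℂ] E)))
    ((Subalgebra.isClosed_topologicalClosure _).preimage (X.conj t).continuous) (fun n => ?_) hM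
  change X.conj t (X.translation n) ∈ X.convAlgebra
  rw [conj_translation]
  exact X.convAlgebra.smul_mem (X.translation_mem_convAlgebra n) _

/-- The representation `φ ↦ M_φ` of the algebra of Laurent polynomials, with values in `𝒜`. -/
def convHom : AddMonoidAlgebra ℂ (Fin k → ℤ) →ₐ[ℂ] X.convAlgebra :=
  AddMonoidAlgebra.lift ℂ X.convAlgebra (Fin k → ℤ)
    { toFun := fun n => ⟨X.translation n.toAdd, X.translation_mem_convAlgebra _⟩
      map_one' := Subtype.ext X.translation_zero
      map_mul' := fun m n => Subtype.ext (X.translation_add m.toAdd n.toAdd) }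

theorem coe_convHom (p : AddMonoidAlgebra ℂ (Fin k → ℤ)) :
    (X.convHom p : E →L[ℂ] E) = X.convOp p.coeff := by
  simp [convHom, AddMonoidAlgebra.lift_apply, convOp, Finsupp.sum]

theorem denseRange_convHom : DenseRange X.convHom := by
  have hadjoin : Algebra.adjoin ℂ (Set.range X.convOp) ≤
      (X.convAlgebra.val.comp X.convHom).range :=
    Algebra.adjoin_le <| Set.range_subset_iff.2 fun φ => ⟨.ofCoeff φ, X.coe_convHom _⟩
  intro M
  rw [closure_subtype, ← Set.range_comp]
  exact closure_mono hadjoin M.2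

instance : IsMulCommutative X.convAlgebra where
  is_comm.comm := X.denseRange_convHom.induction_on₂ (p := fun M N => M * N = N * M)
    (isClosed_eq (by fun_prop) (by fun_prop)) fun p q => by rw [← map_mul, mul_comm, map_mul]

instance : CompleteSpace X.convAlgebra :=
  (Subalgebra.isClosed_topologicalClosure _).completeSpace_coe

instance : NormOneClass X.convAlgebra where
  norm_one := by
    have hunit : X.unitSeq ≠ 0 := fun h => by
      simpa [h] using congrFun X.toSeq_unitSeq 0
    have : Nontrivial E := ⟨X.unitSeq, 0, hunit⟩
    exact norm_one (α := E →L[ℂ] E)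

end ConvAlgebra

section Orbit

variable {X} {M : E →L[ℂ] E}

theorem continuous_conj_of_mem_convAlgebra (hM : M ∈ X.convAlgebra) :
    Continuous fun t => X.conj t M := by
  have hjoint : Continuous fun p : X.convAlgebra × UnitAddTorus (Fin k) => X.conj p.2 p.1 := by
    refine continuous_prod_of_dense_continuous_lipschitzWith _ (X.modBound ^ 2)
      X.denseRange_convHom ?_ fun t => ?_
    · rintro _ ⟨p, rfl⟩
      simp only [coe_convHom, convOp, Finsupp.sum, map_sum, map_smul, conj_translation]
      fun_prop
    · exact LipschitzWith.of_dist_le_mul fun S T => by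
        rw [dist_eq_norm, dist_eq_norm, ← map_sub]
        exact X.norm_conj_le t (S - T : E →L[ℂ] E)
  exact hjoint.comp₂ (continuous_const (y := ⟨M, hM⟩)) continuous_id

theorem IsMultiplier.mFourierCoeff_conj (hM : X.IsMultiplier M)
    (hcont : Continuous fun t => X.conj t M) (n : Fin k → ℤ) :
    mFourierCoeff (fun t => X.conj t M) n = X.coeff M n • X.translation n := by
  rw [← hM.conjCoeff_eq n]
  ext x
  exact (mFourierCoeff_clm_apply (ContinuousLinearMap.apply ℂ E x) hcont n).symm

/-- The converse half is Fourier synthesis: all Fourier coefficients of the orbit of `M` lie in the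
closed space `𝒜`, hence so does its value at `0`, which is `M`. -/
theorem mem_convAlgebra_iff :
    M ∈ X.convAlgebra ↔ X.IsMultiplier M ∧ Continuous fun t => X.conj t M := by
  refine ⟨fun hM => ⟨isMultiplier_of_mem_convAlgebra hM, continuous_conj_of_mem_convAlgebra hM⟩,
    fun ⟨hM, hcont⟩ => ?_⟩
  have hcoeff (n : Fin k → ℤ) :
      mFourierCoeff (fun t => X.conj t M) n ∈ Subalgebra.toSubmodule X.convAlgebra := by
    rw [hM.mFourierCoeff_conj hcont]
    exact X.convAlgebra.smul_mem (X.translation_mem_convAlgebra n) _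
  have hclosed : IsClosed (Subalgebra.toSubmodule X.convAlgebra : Set (E →L[ℂ] E)) :=
    Subalgebra.isClosed_topologicalClosure _
  simpa [conj_zero] using mem_of_forall_mFourierCoeff_mem hclosed hcont hcoeff 0

theorem inv_mem_convAlgebra (u : (E →L[ℂ] E)ˣ) (hu : (u : E →L[ℂ] E) ∈ X.convAlgebra) :
    (↑u⁻¹ : E →L[ℂ] E) ∈ X.convAlgebra := by
  have hu' := mem_convAlgebra_iff.1 hu
  refine mem_convAlgebra_iff.2 ⟨hu'.1.inv, continuous_iff_continuousAt.2 fun t => ?_⟩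
  have hconj (s : UnitAddTorus (Fin k)) :
      X.conj s (↑u⁻¹ : E →L[ℂ] E) = Ring.inverse (X.conj s u) :=
    (Ring.inverse_unit (Units.map (X.conj s : (E →L[ℂ] E) →* (E →L[ℂ] E)) u)).symm
  have hinv : ContinuousAt Ring.inverse (X.conj t u) :=
    NormedRing.inverse_continuousAt (Units.map (X.conj t : (E →L[ℂ] E) →* (E →L[ℂ] E)) u)
  simp only [hconj]
  exact hinv.comp (f := fun s => X.conj s u) hu'.2.continuousAt

end Orbit

section Characters

/-- The point of `ℂ^k` attached to a character of `𝒜`: its coordinates are the values of the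
character at the translations by the standard basis vectors. -/
def point (χ : X.convAlgebra →ₐ[ℂ] ℂ) : Fin k → ℂ :=
  fun i => χ (X.convHom (.single (Pi.single i 1) 1))

variable {X} (χ : X.convAlgebra →ₐ[ℂ] ℂ) {z : Fin k → ℂ}

theorem apply_convHom_single (n : Fin k → ℤ) :
    χ (X.convHom (.single n 1)) = laurentMonomial (X.point χ) n :=
  monoidHom_apply_eq_laurentMonomial
    (((χ.comp X.convHom : _ →ₐ[ℂ] ℂ) : _ →* ℂ).comp (AddMonoidAlgebra.of ℂ (Fin k → ℤ))) n

theorem point_apply_ne_zero (i : Fin k) : X.point χ i ≠ 0 := by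
  have hunit : IsUnit (AddMonoidAlgebra.of ℂ (Fin k → ℤ) (.ofAdd (Pi.single i 1))) :=
    (Group.isUnit _).map _
  exact ((hunit.map X.convHom).map χ).ne_zero

theorem apply_convHom (p : AddMonoidAlgebra ℂ (Fin k → ℤ)) :
    χ (X.convHom p) = laurentPolynomial p.coeff (X.point χ) := by
  have h : χ.comp X.convHom = laurentEval (point_apply_ne_zero χ) :=
    AddMonoidAlgebra.algHom_ext (fun n => by
      simp [apply_convHom_single, laurentEval_apply, laurentPolynomial_single]) (by ext)
  rw [← laurentEval_apply (point_apply_ne_zero χ), ← h, AlgHom.comp_apply]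

theorem norm_laurentPolynomial_point_sub_le (φ : (Fin k → ℤ) →₀ ℂ) (M : X.convAlgebra) :
    ‖laurentPolynomial φ (X.point χ) - χ M‖ ≤ ‖X.convOp φ - M‖ := by
  have hnorm (T : X.convAlgebra) : ‖χ T‖ ≤ ‖T‖ := AlgHom.norm_apply_le_self χ T
  calc ‖laurentPolynomial φ (X.point χ) - χ M‖ = ‖χ (X.convHom (.ofCoeff φ) - M)‖ := by
        rw [map_sub, apply_convHom]
    _ ≤ ‖X.convHom (.ofCoeff φ) - M‖ := hnorm _
    _ = ‖X.convOp φ - M‖ := congrArg (‖· - (M : E →L[ℂ] E)‖) (X.coe_convHom _)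

theorem point_mem_jointSpectrum : X.point χ ∈ X.jointSpectrum :=
  ⟨point_apply_ne_zero χ, fun φ => by simpa using norm_laurentPolynomial_point_sub_le χ φ 0⟩

theorem point_injective : Function.Injective X.point := fun χ ψ h => by
  refine DFunLike.coe_injective (X.denseRange_convHom.equalizer (map_continuous χ)
    (map_continuous ψ) (funext fun p => ?_))
  simp only [Function.comp_apply, apply_convHom, h]

theorem exists_point_eq (hz : z ∈ X.jointSpectrum) : ∃ χ, X.point χ = z := by
  obtain ⟨χ, hχ⟩ := exists_algHom_comp_eq_of_norm_le (f := laurentEval hz.1) (C := 1)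
    X.denseRange_convHom fun p => by
      simpa [laurentEval_apply, ← coe_convHom] using hz.2 p.coeff
  refine ⟨χ, funext fun i => ?_⟩
  rw [point, ← AlgHom.comp_apply, hχ, laurentEval_apply, AddMonoidAlgebra.coeff_single,
    laurentPolynomial_single, one_mul, laurentMonomial_single]

variable (X) in
theorem range_point : Set.range X.point = X.jointSpectrum :=
  Set.Subset.antisymm (Set.range_subset_iff.2 point_mem_jointSpectrum) fun _ => exists_point_eq

end Characters

section Rotation

variable {X} {z : Fin k → ℂ}

variable (X) in
/-- The action of the torus on `𝒜`, by conjugation with the modulations. -/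
def convConj (t : UnitAddTorus (Fin k)) : X.convAlgebra →ₐ[ℂ] X.convAlgebra :=
  ((X.conj t : (E →L[ℂ] E) →ₐ[ℂ] (E →L[ℂ] E)).comp X.convAlgebra.val).codRestrict _
    fun M => X.conj_mem_convAlgebra t M.2

theorem coe_convConj (t : UnitAddTorus (Fin k)) (M : X.convAlgebra) :
    (X.convConj t M : E →L[ℂ] E) = X.conj t M := rfl

theorem continuous_convConj (M : X.convAlgebra) : Continuous fun t => X.convConj t M :=
  (continuous_conj_of_mem_convAlgebra M.2).subtype_mk _

theorem coe_convHom_single (n : Fin k → ℤ) :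
    (X.convHom (.single n 1) : E →L[ℂ] E) = X.translation n := by
  simp [coe_convHom, convOp]

theorem point_comp_convConj (χ : X.convAlgebra →ₐ[ℂ] ℂ) (t : UnitAddTorus (Fin k)) :
    X.point (χ.comp (X.convConj t)) = rotate (X.point χ) t := by
  funext i
  have hconj : X.convConj t (X.convHom (.single (Pi.single i 1) 1)) =
      mFourier (Pi.single i 1) t • X.convHom (.single (Pi.single i 1) 1) :=
    Subtype.ext <| by simp [coe_convConj, coe_convHom_single, conj_translation]
  rw [← laurentMonomial_single (rotate _ t), laurentMonomial_rotate, laurentMonomial_single,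
    point, AlgHom.comp_apply, hconj, map_smul, smul_eq_mul, mul_comm, point]

theorem rotate_mem_jointSpectrum (hz : z ∈ X.jointSpectrum) (t : UnitAddTorus (Fin k)) :
    rotate z t ∈ X.jointSpectrum := by
  obtain ⟨χ, rfl⟩ := exists_point_eq hz
  exact point_comp_convConj χ t ▸ point_mem_jointSpectrum _

theorem mFourierCoeff_convConj (M : X.convAlgebra) (n : Fin k → ℤ) :
    mFourierCoeff (fun t => X.convConj t M) n = X.coeff M n • X.convHom (.single n 1) := by
  have hM := mem_convAlgebra_iff.1 M.2
  have hcoe := mFourierCoeff_clm_apply (Subalgebra.toSubmodule X.convAlgebra).subtypeL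
    (continuous_convConj M) n
  refine Subtype.ext (hcoe.symm.trans ?_)
  simpa [coe_convHom_single] using! hM.1.mFourierCoeff_conj hM.2 n

end Rotation

section GelfandSymbol

variable {X} {z : Fin k → ℂ}

variable (X) in
/-- The Gelfand transform of an element of `𝒜`, transported to the joint spectrum (and extended
by `0`). -/
def gelfandSymbol (M : X.convAlgebra) : (Fin k → ℂ) → ℂ :=
  Function.extend X.point (fun χ => χ M) 0

theorem gelfandSymbol_point (M : X.convAlgebra) (χ : X.convAlgebra →ₐ[ℂ] ℂ) :
    X.gelfandSymbol M (X.point χ) = χ M :=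
  point_injective.extend_apply _ _ χ

theorem tendstoUniformlyOn_gelfandSymbol {ι : Type*} {l : Filter ι} {φ : ι → (Fin k → ℤ) →₀ ℂ}
    {M : X.convAlgebra} (hφ : Tendsto (fun j => X.convOp (φ j)) l (𝓝 M)) :
    TendstoUniformlyOn (fun j => laurentPolynomial (φ j)) (X.gelfandSymbol M) l
      X.jointSpectrum := by
  refine Metric.tendstoUniformlyOn_iff.2 fun ε hε => ?_
  filter_upwards [Metric.tendsto_nhds.1 hφ ε hε] with j hj z hz
  obtain ⟨χ, rfl⟩ := exists_point_eq hz
  rw [dist_comm, dist_eq_norm, gelfandSymbol_point]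
  exact (norm_laurentPolynomial_point_sub_le χ _ M).trans_lt (dist_eq_norm (X.convOp _) _ ▸ hj)

theorem continuousOn_gelfandSymbol (M : X.convAlgebra) :
    ContinuousOn (X.gelfandSymbol M) X.jointSpectrum := by
  obtain ⟨S, hS, hlim⟩ := mem_closure_iff_seq_limit.1 (X.denseRange_convHom M)
  choose p hp using hS
  have hconv : Tendsto (fun j => X.convOp (p j).coeff) atTop (𝓝 M) := by
    simpa only [← coe_convHom, hp] using! (continuous_subtype_val.tendsto M).comp hlim
  exact (tendstoUniformlyOn_gelfandSymbol hconv).continuousOn <| .of_forall fun j =>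
    (continuousOn_laurentPolynomial _).mono fun _ hz => hz.1

theorem gelfandSymbol_rotate_point (M : X.convAlgebra) (χ : X.convAlgebra →ₐ[ℂ] ℂ)
    (t : UnitAddTorus (Fin k)) :
    X.gelfandSymbol M (rotate (X.point χ) t) = χ (X.convConj t M) := by
  rw [← point_comp_convConj, gelfandSymbol_point, AlgHom.comp_apply]

theorem isContinuousSymbol_gelfandSymbol (M : X.convAlgebra) :
    X.IsContinuousSymbol M (X.gelfandSymbol M) := by
  refine ⟨continuousOn_gelfandSymbol M, fun z hz n => ?_⟩
  obtain ⟨χ, rfl⟩ := exists_point_eq hz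
  calc mFourierCoeff (fun t => X.gelfandSymbol M (rotate (X.point χ) t)) n
      = mFourierCoeff (fun t => χ (X.convConj t M)) n := by simp only [gelfandSymbol_rotate_point]
    _ = χ (mFourierCoeff (fun t => X.convConj t M) n) :=
        mFourierCoeff_clm_apply χ.toContinuousLinearMap (continuous_convConj M) n
    _ = X.coeff M n * laurentMonomial (X.point χ) n := by
        rw [mFourierCoeff_convConj, map_smul, smul_eq_mul, apply_convHom_single]

theorem image_gelfandSymbol (M : X.convAlgebra) :
    X.gelfandSymbol M '' X.jointSpectrum = spectrum ℂ (M : E →L[ℂ] E) := by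
  rw [spectrum_coe_of_forall_inv_mem inv_mem_convAlgebra, ← range_point, ← Set.range_comp]
  ext c
  simp only [mem_spectrum_iff_exists_algHom, Set.mem_range,
    Function.comp_apply, gelfandSymbol_point]

end GelfandSymbol

namespace IsContinuousSymbol

variable {X} {M : E →L[ℂ] E} {f g : (Fin k → ℂ) → ℂ} {z : Fin k → ℂ}

theorem continuous_comp_rotate (hg : X.IsContinuousSymbol M g) (hz : z ∈ X.jointSpectrum) :
    Continuous fun t => g (rotate z t) :=
  hg.1.comp_continuous (continuous_rotate z) (rotate_mem_jointSpectrum hz)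

theorem eqOn (hf : X.IsContinuousSymbol M f) (hg : X.IsContinuousSymbol M g) :
    Set.EqOn f g X.jointSpectrum := fun z hz => by
  have h := eq_of_mFourierCoeff_eq (hf.continuous_comp_rotate hz) (hg.continuous_comp_rotate hz)
    fun n => (hf.2 z hz n).trans (hg.2 z hz n).symm
  simpa only [rotate_zero] using congrFun h 0

theorem eq_symbol (hg : X.IsContinuousSymbol M g) (hz : z ∈ X.jointSpectrum)
    (hs : Summable fun n => X.coeff M n * laurentMonomial z n) : g z = X.symbol M z := by
  have hcoeff : mFourierCoeff (fun t => g (rotate z t)) =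
      fun n => X.coeff M n * laurentMonomial z n := funext (hg.2 z hz)
  have hsum := hasSum_mFourierCoeff_mul_mFourier (hg.continuous_comp_rotate hz) (hcoeff ▸ hs) 0
  simp only [hcoeff, mFourier_apply_zero, mul_one, rotate_zero] at hsum
  exact hsum.tsum_eq.symm

end IsContinuousSymbol

end BanachSequenceSpace

end

theorem theorem7 {k : ℕ} {E : Type*} [NormedAddCommGroup E] [NormedSpace ℂ E] [CompleteSpace E]
    (X : BanachSequenceSpace k E) :
    (∀ M : E →L[ℂ] E, X.IsMultiplier M →
      (∀ z ∈ interior X.jointSpectrum,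
        Summable fun n : Fin k → ℤ => X.coeff M n * laurentMonomial z n) ∧
      closure (X.symbol M '' interior X.jointSpectrum) ⊆ spectrum ℂ M) ∧
    (∀ M ∈ X.convAlgebra,
      (∃ g : (Fin k → ℂ) → ℂ, X.IsContinuousSymbol M g) ∧
      ∀ g : (Fin k → ℂ) → ℂ, X.IsContinuousSymbol M g →
        (∀ z ∈ X.jointSpectrum,
          (Summable fun n : Fin k → ℤ => X.coeff M n * laurentMonomial z n) →
            g z = X.symbol M z) ∧
        (∀ φ : ℕ → ((Fin k → ℤ) →₀ ℂ),
          Tendsto (fun j => X.convOp (φ j)) atTop (𝓝 M) →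
            TendstoUniformlyOn (fun j => laurentPolynomial (φ j)) g atTop X.jointSpectrum) ∧
        g '' X.jointSpectrum = spectrum ℂ M) := by
  refine ⟨fun M hM => ⟨fun _ => hM.summable_coeff_mul_laurentMonomial, ?_⟩, fun M hM => ?_⟩
  · refine closure_minimal ?_ (spectrum.isClosed M)
    rintro _ ⟨z, hz, rfl⟩
    exact hM.symbol_mem_spectrum hz
  · lift M to X.convAlgebra using hM
    have hgelfand := BanachSequenceSpace.isContinuousSymbol_gelfandSymbol M
    refine ⟨⟨_, hgelfand⟩, fun g hg => ?_⟩
    have hg_eq := hgelfand.eqOn hg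
    exact ⟨fun z hz hs => hg.eq_symbol hz hs,
      fun φ hφ => (BanachSequenceSpace.tendstoUniformlyOn_gelfandSymbol hφ).congr_right hg_eq,
      hg_eq.image_eq ▸ BanachSequenceSpace.image_gelfandSymbol M⟩
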